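/- Let $n,k$ be natural numbers with $k>\sqrt{2n}$. For a symmetric matrix $C\in\mathbb{R}^{n\times n}$ and $V\in\mathbb{R}^{k\times n}$ with columns $v_1,\dots,v_n$, put $g_i(V)=\sum_{j\neq i}c_{ij}v_j$ and $y_i=\|g_i(V)\|$ (Euclidean norm), let $C_0$ be $C$ with its diagonal replaced by zero, and $D_y=\operatorname{diag}(y_1,\dots,y_n)$. The Mixing map $M$ sends $V$ to the matrix obtained by performing, for $i=1,\dots,n$ in this order, the update $v_i:=-g_i/\|g_i\|$ with $g_i$ computed from the current columns. Call $V$ a first-order critical point if $\|v_i\|=1$ for all $i$ and $V(C_0+D_y)=0$. Then for almost every symmetric $C$ (with respect to Lebesgue measure on the space of symmetric $n\times n$ matrices) the following holds for every first-order critical point $V$ that is non-degenerate, i.e. for which there is $\delta>0$ with $\|g_i(V)\|\ge\delta$ for all $i$. If $V^{\mathsf T}V$ is not an optimal solution of the semidefinite program $$\min\ \langle C,X\rangle\quad\text{subject to } X\succeq 0,\ X_{ii}=1\ (i=1,\dots,n),$$ then $V$ is an unstable fixed point of $M$: $M(V)=V$, $M$ is differentiable at $V$, and the Jacobian matrix of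 $M$ at $V$, of size $nk\times nk$, has spectral radius (largest modulus of a complex eigenvalue) strictly greater than $1$. -/

import Mathlib

open MeasureTheory

noncomputable section

namespace MixingMethod

/-- A matrix `V ∈ ℝ^{k × n}`, given by its columns `v₁, …, vₙ ∈ ℝᵏ` (with the Euclidean norm). -/
abbrev Config (k n : ℕ) : Type := Fin n → EuclideanSpace ℝ (Fin k)

/-- The symmetric matrix with entries `c_{ij} = c_{ji} = w {i, j}`. Lebesgue measure on the
coordinates `w : Sym2 (Fin n) → ℝ` is Lebesgue measure on the `n(n+1)/2`-dimensional space of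
symmetric matrices. -/
def symMatrix {n : ℕ} (w : Sym2 (Fin n) → ℝ) : Matrix (Fin n) (Fin n) ℝ :=
  Matrix.of fun i j => w s(i, j)

/-- The matrix `C` with its diagonal replaced by zero. As all `vᵢ` have norm one, the diagonal of
`C` only adds a constant to the objective, and the method works with `c_{ii} = 0`. -/
def offDiag {n : ℕ} (C : Matrix (Fin n) (Fin n) ℝ) : Matrix (Fin n) (Fin n) ℝ :=
  Matrix.of fun i j => if i = j then 0 else C i j

/-- The vector `gᵢ = ∑_{j ≠ i} c_{ij} v_j` (the product `V cᵢ`, for `c_{ii} = 0`). -/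
def mixVec {k n : ℕ} (C : Matrix (Fin n) (Fin n) ℝ) (V : Config k n) (i : Fin n) :
    EuclideanSpace ℝ (Fin k) :=
  ∑ j, offDiag C i j • V j

/-- The update of column `i`: `vᵢ := -gᵢ / ‖gᵢ‖`, computed from the current columns. -/
def mixStep {k n : ℕ} (C : Matrix (Fin n) (Fin n) ℝ) (V : Config k n) (i : Fin n) : Config k n :=
  Function.update V i (-(‖mixVec C V i‖⁻¹ • mixVec C V i))

/-- The Mixing map `M`: one cyclic sweep of the updates, for `i = 1, …, n` in this order. -/
def mixMap {k n : ℕ} (C : Matrix (Fin n) (Fin n) ℝ) (V : Config k n) : Config k n :=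
  (List.finRange n).foldl (mixStep C) V

/-- The vector `y` with `yᵢ = ‖V cᵢ‖`. -/
def mixNorm {k n : ℕ} (C : Matrix (Fin n) (Fin n) ℝ) (V : Config k n) : Fin n → ℝ :=
  fun i => ‖mixVec C V i‖

/-- `V` is a first-order critical point: its columns are unit vectors and `V (C + D_y) = 0`, where
`yᵢ = ‖V cᵢ‖` (and `c_{ii} = 0`). The `j`-th equation is the vanishing of the `j`-th column of
`V (C + D_y)`. -/
structure IsFirstOrderCritical {k n : ℕ} (C : Matrix (Fin n) (Fin n) ℝ) (V : Config k n) :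
    Prop where
  norm_eq_one : ∀ i, ‖V i‖ = 1
  mul_eq_zero : ∀ j, ∑ i, (offDiag C + Matrix.diagonal (mixNorm C V)) i j • V i = 0

/-- The norms `‖V cᵢ‖` do not degenerate: they are bounded below by a constant `δ > 0`. -/
def IsNondegenerate {k n : ℕ} (C : Matrix (Fin n) (Fin n) ℝ) (V : Config k n) : Prop :=
  ∃ δ : ℝ, 0 < δ ∧ ∀ i, δ ≤ ‖mixVec C V i‖

/-- `X` is feasible for the SDP: `X ⪰ 0` and `X_{ii} = 1` for all `i`. -/
def IsSDPFeasible {n : ℕ} (X : Matrix (Fin n) (Fin n) ℝ) : Prop :=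
  X.PosSemidef ∧ ∀ i, X i i = 1

/-- `X` is an optimal solution of the SDP: minimise `⟨C, X⟩ = tr (Cᵀ X)` over feasible `X`. -/
def IsSDPOptimal {n : ℕ} (C X : Matrix (Fin n) (Fin n) ℝ) : Prop :=
  IsSDPFeasible X ∧
    ∀ Y : Matrix (Fin n) (Fin n) ℝ, IsSDPFeasible Y →
      (C.transpose * X).trace ≤ (C.transpose * Y).trace

/-- The Jacobian matrix of `F` at `V`: the entry at `((i, a), (j, b))` is the partial derivative of
the `a`-th coordinate of the `i`-th column of `F` in the `b`-th coordinate of the `j`-th column. -/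
def jacobian {k n : ℕ} (F : Config k n → Config k n) (V : Config k n) :
    Matrix (Fin n × Fin k) (Fin n × Fin k) ℝ :=
  Matrix.of fun p q =>
    (fderiv ℝ F V (Pi.single q.1 (EuclideanSpace.single q.2 (1 : ℝ)))) p.1 p.2

/-- `V` is an unstable fixed point of `F`: `F` fixes `V` and is differentiable there, and its
Jacobian has spectral radius (over the complex eigenvalues) larger than one. -/
structure IsUnstableFixedPoint {k n : ℕ} (F : Config k n → Config k n) (V : Config k n) :
    Prop where
  fixed : F V = V
  differentiableAt : DifferentiableAt ℝ F V
  one_lt_spectralRadius :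
    1 < spectralRadius ℂ ((jacobian F V).map (fun x : ℝ => (x : ℂ)))

end MixingMethod

end

/-!
Let `V` be a non-degenerate first-order critical point, `yᵢ = ‖gᵢ(V)‖` and `S = C + D_y` (with the
diagonal of `C` replaced by zero), so that `V S = 0` and `S` has the positive diagonal `y`.

*Almost every `C` forces `rank V < k`.* If the columns of `V` span `ℝᵏ`, then `S` is a symmetric
matrix whose kernel has dimension at least `k`. Such matrices have the form `B T Bᵀ`, where `T` is
symmetric of size `n - k` and the rows of `B` in some index set `J` of size `n - k` form the
identity (`exists_eq_completeRows`). Together with the free diagonal this describes all such `C`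
off the diagonal by `n (n + 1) / 2 - k (k + 1) / 2 + n` parameters, and the diagonal of `C` is
absorbed in the last `n` of them. As `2 n < k²`, these are fewer than `n (n + 1) / 2`, so the
exceptional `C` lie in a finite union of smooth images of spaces of smaller dimension, which is
Lebesgue-null (`ae_exists_orthogonal`).

*Reduction to Gauss–Seidel.* Otherwise some `r ≠ 0` is orthogonal to all columns of `V`. In the
directions `x ⊗ r`, whose `i`-th column is `xᵢ r`, the norms `‖gᵢ‖` do not change to first order, so
the derivative of the Mixing map at `V` sends `x ⊗ r` to `z ⊗ r`, where `z` is the result of one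
Gauss–Seidel sweep for `S x = 0` started at `x` (`exists_hasFDerivAt_foldl`).

*Growth.* If `S` were positive semidefinite, then `VᵀV` would be optimal by weak duality
(`isSDPOptimal_of_posSemidef`); hence the energy `xᵀ S x` is negative for some `x`. A Gauss–Seidel
step in coordinate `i` lowers the energy by `(S x)ᵢ² / yᵢ`, and over a sweep the decrease controls
the whole residual `‖S x‖²` (`exists_mulVec_sq_le`). The residual in turn controls `|xᵀ S x|`, even
when `S` is singular (`exists_abs_energy_le_residual`). So negative energy is multiplied by at least
a fixed factor larger than one in each sweep, the powers of the Jacobian grow geometrically on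
`x ⊗ r` (`exists_gsSweep_growth`), and Gelfand's formula gives a spectral radius larger than one
(`le_spectralRadius_of_growth`).
-/

namespace MixingMethod

/-! ### Almost every cost matrix admits only rank-deficient critical points -/

/-- A `C¹` map from a space of dimension less than `card ι` into `ι → ℝ` has Lebesgue-null range. -/
theorem volume_range_eq_zero {ι E : Type*} [Fintype ι] [NormedAddCommGroup E] [NormedSpace ℝ E]
    [FiniteDimensional ℝ E] {f : E → ι → ℝ} (hf : ContDiff ℝ 1 f)
    (h : Module.finrank ℝ E < Fintype.card ι) : volume (Set.range f) = 0 := by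
  rw [← hausdorffMeasure_pi_real]
  have h1 : dimH (Set.range f) < ((Fintype.card ι : NNReal) : ENNReal) :=
    hf.dimH_range_le.trans_lt (by exact_mod_cast h)
  simpa using hausdorffMeasure_of_dimH_lt h1

/-- The `n × J` matrix whose rows in `J` form the identity and whose other rows are those
of `W`. -/
def completeRows {n : ℕ} (J : Finset (Fin n)) (W : {i // i ∉ J} → J → ℝ) (i : Fin n) (a : J) : ℝ :=
  if h : i ∈ J then (if i = a then 1 else 0) else W ⟨i, h⟩ a

/-- The symmetric matrix `B T Bᵀ + diag d`, where `B = completeRows J W` and the symmetric matrix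
`T` is given by its entries on unordered pairs. -/
def lowRankAddDiag {n : ℕ} (J : Finset (Fin n))
    (p : ({i // i ∉ J} → J → ℝ) × (Sym2 J → ℝ) × (Fin n → ℝ)) : Sym2 (Fin n) → ℝ :=
  Sym2.lift ⟨fun i j => (∑ a, ∑ b, completeRows J p.1 i a * p.2.1 s(a, b) * completeRows J p.1 j b)
    + if i = j then p.2.2 i else 0, fun i j => by
      beta_reduce
      rw [Finset.sum_comm]
      congr 1
      · refine Finset.sum_congr rfl fun a _ => Finset.sum_congr rfl fun b _ => ?_
        rw [Sym2.eq_swap]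
        ring
      · by_cases h : i = j
        · simp [h]
        · simp [h, Ne.symm h]⟩

theorem contDiff_lowRankAddDiag {n : ℕ} (J : Finset (Fin n)) :
    ContDiff ℝ 1 (lowRankAddDiag J) := by
  have hB : ∀ (i : Fin n) (a : J), ContDiff ℝ 1
      fun p : ({i // i ∉ J} → J → ℝ) × (Sym2 J → ℝ) × (Fin n → ℝ) => completeRows J p.1 i a := by
    intro i a
    unfold completeRows
    split_ifs with h <;> fun_prop
  refine contDiff_pi.2 (Sym2.ind fun i j => ?_)
  simp only [lowRankAddDiag, Sym2.lift_mk]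
  refine ContDiff.add (ContDiff.sum fun a _ => ContDiff.sum fun b _ => ?_) ?_
  · exact ((hB i a).mul (by fun_prop)).mul (hB j b)
  · split_ifs <;> fun_prop

/-- The parameter count: prescribing a kernel of dimension `k` costs `k (k + 1) / 2` dimensions,
more than the `n` dimensions gained from the free diagonal. -/
theorem volume_range_lowRankAddDiag {n k : ℕ} (hk : 2 * n < k * k) (J : Finset (Fin n))
    (hJ : J.card + k = n) : volume (Set.range (lowRankAddDiag J)) = 0 := by
  refine volume_range_eq_zero (contDiff_lowRankAddDiag J) ?_
  have hc : Fintype.card {i // i ∉ J} = k := by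
    rw [Fintype.card_subtype_compl]
    simp
    omega
  have h1 : Module.finrank ℝ (({i // i ∉ J} → J → ℝ) × (Sym2 J → ℝ) × (Fin n → ℝ))
      = k * J.card + ((J.card + 1).choose 2 + n) := by
    rw [Module.finrank_prod, Module.finrank_prod, Module.finrank_pi_fintype]
    simp [Sym2.card, hc]
  rw [h1, Sym2.card, Fintype.card_fin]
  obtain ⟨m, hm⟩ : ∃ m, m = J.card := ⟨_, rfl⟩
  rw [← hm] at hJ ⊢
  have t : ∀ q : ℕ, 2 * (q + 1).choose 2 = (q + 1) * q := fun q => by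
    rw [Nat.choose_two_right, Nat.add_sub_cancel]
    exact Nat.mul_div_cancel' (even_iff_two_dvd.1 (by rw [mul_comm]; exact Nat.even_mul_succ_self q))
  have t1 := t m
  have t2 := t n
  subst hJ
  nlinarith

/-- A symmetric matrix annihilated by vectors `v₁, …, vₙ` that span `ℝᵏ` is of the form `B T Bᵀ`:
choose a basis among the `vᵢ`, indexed by the complement of `J`; expanding the other `v_a` in it
expresses the rows of `S` outside `J` through those in `J`. -/
theorem exists_eq_completeRows {n k : ℕ} {S : Fin n → Fin n → ℝ} (hS : ∀ i j, S i j = S j i)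
    {V : Config k n} (hV : Submodule.span ℝ (Set.range V) = ⊤)
    (h0 : ∀ j, ∑ i, S i j • V i = 0) :
    ∃ J : Finset (Fin n), J.card + k = n ∧ ∃ W : {i // i ∉ J} → J → ℝ, ∀ i j,
      S i j = ∑ a : J, ∑ b : J, completeRows J W i a * S a b * completeRows J W j b := by
  classical
  obtain ⟨κ, e, he, hspan, hli⟩ := exists_linearIndependent' ℝ V
  have : Fintype κ := Fintype.ofInjective e he
  let b : Module.Basis κ ℝ (EuclideanSpace ℝ (Fin k)) :=
    Module.Basis.mk hli (by rw [hspan, hV])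
  have hb : ∀ x, b x = V (e x) := fun x => by simp [b]
  have hcard : Fintype.card κ = k := by
    rw [← Module.finrank_eq_card_basis b, finrank_euclideanSpace_fin]
  let I : Finset (Fin n) := Finset.univ.image e
  have hI : I.card = k := by
    rw [Finset.card_image_of_injective _ he, Finset.card_univ, hcard]
  have hmem : ∀ i, i ∉ Iᶜ → ∃ x, e x = i := fun i hi => by
    simpa [I] using hi
  choose r hr using hmem
  let W : {i // i ∉ Iᶜ} → (Iᶜ : Finset (Fin n)) → ℝ := fun i a => -b.repr (V a) (r i i.2)
  have hrow : ∀ i j, S i j = ∑ a, completeRows Iᶜ W i a * S a j := by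
    intro i j
    by_cases h : i ∈ Iᶜ
    · simp only [completeRows, h, dif_pos]
      rw [Finset.sum_eq_single (⟨i, h⟩ : (Iᶜ : Finset (Fin n)))]
      · simp
      · intro a _ ha
        rw [if_neg, zero_mul]
        rintro rfl
        exact ha rfl
      · simp
    · simp only [completeRows, h, dif_neg, not_false_eq_true]
      -- the coordinate of `∑ S i j • V i = 0` along the basis vector `V i`
      have h1 : ∑ l, S l j * b.repr (V l) (r i h) = 0 := by
        have := congrArg (fun v => b.repr v (r i h)) (h0 j)
        simpa using this
      rw [← Finset.sum_add_sum_compl I, ← Finset.sum_coe_sort Iᶜ] at h1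
      have h2 : ∑ l ∈ I, S l j * b.repr (V l) (r i h) = S i j := by
        rw [Finset.sum_image he.injOn, Finset.sum_eq_single (r i h)]
        · rw [← hb, hr]
          simp
        · intro x _ hx
          rw [← hb]
          simp [hx]
        · simp
      rw [h2] at h1
      simp only [W, neg_mul, Finset.sum_neg_distrib]
      rw [eq_neg_of_add_eq_zero_left h1]
      simp [mul_comm]
  refine ⟨Iᶜ, ?_, W, fun i j => ?_⟩
  · have := I.card_le_univ
    rw [Finset.card_compl]
    simp only [Fintype.card_fin] at *
    omega
  · rw [hrow i j]
    refine Finset.sum_congr rfl fun a _ => ?_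
    rw [hS a j, hrow j a, Finset.mul_sum]
    refine Finset.sum_congr rfl fun c _ => ?_
    rw [hS c a]
    ring

theorem offDiag_symMatrix_comm {n : ℕ} (w : Sym2 (Fin n) → ℝ) (i j : Fin n) :
    offDiag (symMatrix w) i j = offDiag (symMatrix w) j i := by
  simp only [offDiag, symMatrix, Matrix.of_apply, eq_comm (a := i), Sym2.eq_swap (a := i)]

theorem mem_range_lowRankAddDiag {n k : ℕ} {w : Sym2 (Fin n) → ℝ} {V : Config k n}
    (hV : Submodule.span ℝ (Set.range V) = ⊤) (y : Fin n → ℝ)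
    (h0 : ∀ j, ∑ i, (offDiag (symMatrix w) + Matrix.diagonal y) i j • V i = 0) :
    ∃ J : Finset (Fin n), J.card + k = n ∧ w ∈ Set.range (lowRankAddDiag J) := by
  have hsymm : ∀ i j, (offDiag (symMatrix w) + Matrix.diagonal y) i j =
      (offDiag (symMatrix w) + Matrix.diagonal y) j i := fun i j => by
    rw [Matrix.add_apply, Matrix.add_apply, offDiag_symMatrix_comm, ← Matrix.diagonal_transpose y,
      Matrix.transpose_apply, Matrix.diagonal_transpose]
  obtain ⟨J, hJ, W, h⟩ := exists_eq_completeRows hsymm hV h0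
  refine ⟨J, hJ, ⟨W, Sym2.lift ⟨fun a b => (offDiag (symMatrix w) + Matrix.diagonal y) a b,
    fun a b => hsymm a b⟩, fun i => w s(i, i) - y i⟩, funext (Sym2.ind fun i j => ?_)⟩
  simp only [lowRankAddDiag, Sym2.lift_mk]
  rw [← h]
  by_cases hij : i = j
  · subst hij
    simp [offDiag]
  · simp [offDiag, symMatrix, hij]

/-- For almost every `C`, every `V` with `V (C + D_y) = 0` has rank less than `k`. -/
theorem ae_exists_orthogonal {n k : ℕ} (hk : 2 * n < k * k) :
    ∀ᵐ w : Sym2 (Fin n) → ℝ ∂volume, ∀ V : Config k n, IsFirstOrderCritical (symMatrix w) V →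
      ∃ r : EuclideanSpace ℝ (Fin k), r ≠ 0 ∧ ∀ i, inner ℝ (V i) r = 0 := by
  have h : ∀ᵐ w : Sym2 (Fin n) → ℝ ∂volume,
      ∀ J : Finset (Fin n), J.card + k = n → w ∉ Set.range (lowRankAddDiag J) := by
    refine ae_all_iff.2 fun J => ?_
    by_cases hJ : J.card + k = n
    · filter_upwards [measure_eq_zero_iff_ae_notMem.1 (volume_range_lowRankAddDiag hk J hJ)]
        with w hw _ using hw
    · exact Filter.Eventually.of_forall fun w h => absurd h hJ
  filter_upwards [h] with w hw V hV
  by_cases hspan : Submodule.span ℝ (Set.range V) = ⊤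
  · obtain ⟨J, hJ, hmem⟩ := mem_range_lowRankAddDiag hspan _ hV.mul_eq_zero
    exact absurd hmem (hw J hJ)
  · have h1 : (Submodule.span ℝ (Set.range V))ᗮ ≠ ⊥ := fun h =>
      hspan (Submodule.orthogonal_eq_bot_iff.1 h)
    obtain ⟨r, hr, hr0⟩ := Submodule.exists_mem_ne_zero_of_ne_bot h1
    exact ⟨r, hr0, fun i => (Submodule.mem_orthogonal _ _).1 hr _
      (Submodule.subset_span ⟨i, rfl⟩)⟩

/-! ### Growth of powers and the spectral radius -/

open Filter Topology in
attribute [local instance] Matrix.linftyOpNormedRing Matrix.linftyOpNormedAlgebra in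
/-- By Gelfand's formula, geometric growth of an orbit bounds the spectral radius from below. -/
theorem le_spectralRadius_of_growth {ι : Type*} [Fintype ι] [DecidableEq ι] (A : Matrix ι ι ℂ)
    (v : ι → ℂ) {c ρ : ℝ} (hc : 0 < c) (hρ : 0 ≤ ρ)
    (h : ∀ m : ℕ, c * ρ ^ m ≤ ‖(A ^ m).mulVec v‖) :
    ENNReal.ofReal ρ ≤ spectralRadius ℂ A := by
  have hv : 0 < ‖v‖ := by
    have := h 0
    simp only [pow_zero, mul_one, Matrix.one_mulVec] at this
    linarith
  have hcomplete : CompleteSpace (Matrix ι ι ℂ) := FiniteDimensional.complete ℂ _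
  have hA := spectrum.pow_norm_pow_one_div_tendsto_nhds_spectralRadius A
  -- the `m`-th root of the lower bound `(c / ‖v‖) ρ ^ m` for `‖A ^ m‖` tends to `ρ`
  have hlow : Tendsto (fun m : ℕ => ENNReal.ofReal ((c / ‖v‖) ^ (1 / m : ℝ) * ρ)) atTop
      (𝓝 (ENNReal.ofReal ρ)) := by
    refine ENNReal.tendsto_ofReal ?_
    have h1 : Tendsto (fun m : ℕ => (c / ‖v‖) ^ (1 / m : ℝ)) atTop (𝓝 1) := by
      have h2 := ((Real.continuous_const_rpow (div_pos hc hv).ne').tendsto 0).comp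
        (tendsto_one_div_atTop_nhds_zero_nat (𝕜 := ℝ))
      rw [Real.rpow_zero] at h2
      exact h2
    simpa using h1.mul_const ρ
  refine le_of_tendsto_of_tendsto hlow hA ?_
  filter_upwards [eventually_gt_atTop 0] with m hm
  refine ENNReal.ofReal_le_ofReal ?_
  have h3 : c / ‖v‖ * ρ ^ m ≤ ‖A ^ m‖ := by
    rw [div_mul_eq_mul_div, div_le_iff₀ hv]
    exact (h m).trans (Matrix.linfty_opNorm_mulVec _ _)
  calc (c / ‖v‖) ^ (1 / m : ℝ) * ρ
      = (c / ‖v‖) ^ (1 / m : ℝ) * (ρ ^ m) ^ (1 / m : ℝ) := by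
        rw [one_div, Real.pow_rpow_inv_natCast hρ hm.ne']
    _ = (c / ‖v‖ * ρ ^ m) ^ (1 / m : ℝ) :=
        (Real.mul_rpow (div_pos hc hv).le (pow_nonneg hρ m)).symm
    _ ≤ ‖A ^ m‖ ^ (1 / m : ℝ) := by gcongr

/-! ### The Gauss–Seidel sweep of an indefinite matrix -/

section GaussSeidel

variable {ι : Type*} [Fintype ι]

/-- The quadratic form `xᵀ S x`. -/
def energy (S : Matrix ι ι ℝ) (x : ι → ℝ) : ℝ :=
  x ⬝ᵥ S.mulVec x

theorem exists_abs_energy_le_norm (S : Matrix ι ι ℝ) :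
    ∃ B : ℝ, 0 ≤ B ∧ ∀ x : ι → ℝ, |energy S x| ≤ B * ‖x‖ ^ 2 := by
  refine ⟨∑ i, ∑ j, |S i j|, by positivity, fun x => ?_⟩
  simp only [energy, dotProduct, Matrix.mulVec, Finset.mul_sum, Finset.sum_mul]
  refine (Finset.abs_sum_le_sum_abs _ _).trans (Finset.sum_le_sum fun i _ =>
    (Finset.abs_sum_le_sum_abs _ _).trans (Finset.sum_le_sum fun j _ => ?_))
  have hi := norm_le_pi_norm x i
  have hj := norm_le_pi_norm x j
  rw [Real.norm_eq_abs] at hi hj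
  rw [abs_mul, abs_mul]
  calc |x i| * (|S i j| * |x j|) ≤ ‖x‖ * (|S i j| * ‖x‖) := by gcongr
    _ = |S i j| * ‖x‖ ^ 2 := by ring

variable [DecidableEq ι]

/-- The Gauss–Seidel update of coordinate `i` for the linear system `S x = 0`: the increment of
`xᵢ` makes the `i`-th equation hold, provided `S i i ≠ 0`. -/
noncomputable def gsStep (S : Matrix ι ι ℝ) (x : ι → ℝ) (i : ι) : ι → ℝ :=
  Function.update x i (x i - (S i i)⁻¹ * S.mulVec x i)

/-- The successive Gauss–Seidel updates of the coordinates in the list `l`. -/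
noncomputable def gsSweep (S : Matrix ι ι ℝ) (l : List ι) (x : ι → ℝ) : ι → ℝ :=
  l.foldl (gsStep S) x

theorem gsStep_eq (S : Matrix ι ι ℝ) (x : ι → ℝ) (i : ι) :
    gsStep S x i = x - Pi.single i ((S i i)⁻¹ * S.mulVec x i) := by
  ext j
  by_cases h : j = i
  · subst h
    simp [gsStep]
  · simp [gsStep, h]

theorem mulVec_gsStep (S : Matrix ι ι ℝ) (x : ι → ℝ) (i j : ι) :
    S.mulVec (gsStep S x i) j = S.mulVec x j - S j i * ((S i i)⁻¹ * S.mulVec x i) := by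
  simp [gsStep_eq, Matrix.mulVec_sub, Matrix.mulVec_single]

theorem energy_gsStep {S : Matrix ι ι ℝ} (hS : S.IsSymm) (x : ι → ℝ) {i : ι} (hi : 0 < S i i) :
    energy S (gsStep S x i) = energy S x - (S i i)⁻¹ * S.mulVec x i ^ 2 := by
  have h1 : x ⬝ᵥ S.mulVec (Pi.single i ((S i i)⁻¹ * S.mulVec x i))
      = S.mulVec x i * ((S i i)⁻¹ * S.mulVec x i) := by
    rw [Matrix.dotProduct_mulVec, ← Matrix.mulVec_transpose, hS.eq, dotProduct_single]
  rw [energy, energy, gsStep_eq, Matrix.mulVec_sub, sub_dotProduct, dotProduct_sub, dotProduct_sub,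
    h1, single_dotProduct, single_dotProduct]
  simp only [Matrix.mulVec_single, Pi.smul_apply, Matrix.col_apply, MulOpposite.smul_eq_mul_unop,
    MulOpposite.unop_op]
  field_simp
  ring

/-- A sweep lowers the energy, and the residual `S x` before the sweep is controlled by the
decrease. -/
theorem exists_mulVec_sq_le {S : Matrix ι ι ℝ} (hS : S.IsSymm) (hd : ∀ i, 0 < S i i)
    (l : List ι) : ∃ K : ℝ, 0 ≤ K ∧ ∀ x, energy S (gsSweep S l x) ≤ energy S x ∧
      ∀ j ∈ l, S.mulVec x j ^ 2 ≤ K * (energy S x - energy S (gsSweep S l x)) := by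
  induction l with
  | nil => exact ⟨0, le_rfl, fun x => ⟨le_rfl, by simp⟩⟩
  | cons i l ih =>
    obtain ⟨K, hK, h⟩ := ih
    have hsum : ∀ j, 2 * S j i ^ 2 * (S i i)⁻¹ ≤ ∑ j, 2 * S j i ^ 2 * (S i i)⁻¹ := fun j =>
      Finset.single_le_sum (f := fun j => 2 * S j i ^ 2 * (S i i)⁻¹)
        (fun j _ => by have := hd i; positivity) (Finset.mem_univ j)
    set Q := ∑ j, 2 * S j i ^ 2 * (S i i)⁻¹ with hQ
    have hQ0 : 0 ≤ Q := Finset.sum_nonneg fun j _ => by have := hd i; positivity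
    refine ⟨2 * K + Q + S i i, by have := hd i; positivity, fun x => ?_⟩
    obtain ⟨hle, hres⟩ := h (gsStep S x i)
    have he := energy_gsStep hS x (hd i)
    have hstep : 0 ≤ energy S x - energy S (gsStep S x i) := by
      rw [he]
      have := hd i
      have : 0 ≤ (S i i)⁻¹ * S.mulVec x i ^ 2 := by positivity
      linarith
    have hfold : gsSweep S (i :: l) x = gsSweep S l (gsStep S x i) := rfl
    rw [hfold]
    set a := energy S x - energy S (gsStep S x i) with ha
    set b := energy S (gsStep S x i) - energy S (gsSweep S l (gsStep S x i)) with hb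
    have hb0 : 0 ≤ b := sub_nonneg.2 hle
    have hab : energy S x - energy S (gsSweep S l (gsStep S x i)) = a + b := by
      rw [ha, hb]
      ring
    have ha' : a = (S i i)⁻¹ * S.mulVec x i ^ 2 := by
      rw [ha, he]
      ring
    refine ⟨by linarith, fun j hj => ?_⟩
    rw [hab]
    rcases List.mem_cons.1 hj with rfl | hj
    · have h1 : S.mulVec x j ^ 2 = S j j * a := by
        rw [ha', mul_inv_cancel_left₀ (hd j).ne']
      have := hd j
      rw [h1]
      gcongr
      · linarith
      · linarith
    -- the step in coordinate `i` changes the `j`-th residual by `S j i * (S i i)⁻¹ * (S x)ᵢ`,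
    -- whose square is a multiple of the energy decrease `a` of that step
    · have h1 := hres j hj
      rw [mulVec_gsStep] at h1
      have h2 : 2 * (S j i * ((S i i)⁻¹ * S.mulVec x i)) ^ 2 = 2 * S j i ^ 2 * (S i i)⁻¹ * a := by
        rw [ha']
        ring
      have h3 : 2 * S j i ^ 2 * (S i i)⁻¹ * a ≤ Q * a := by
        gcongr
        exact hsum j
      have h4 : S.mulVec x j ^ 2 ≤ 2 * (S.mulVec x j - S j i * ((S i i)⁻¹ * S.mulVec x i)) ^ 2
          + 2 * (S j i * ((S i i)⁻¹ * S.mulVec x i)) ^ 2 := by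
        nlinarith [sq_nonneg (S.mulVec x j - 2 * (S j i * ((S i i)⁻¹ * S.mulVec x i)))]
      have h5 := mul_nonneg hK hstep
      have h6 := mul_nonneg hQ0 hb0
      have h7 := mul_nonneg (hd i).le (add_nonneg hstep hb0)
      nlinarith

/-- With `G` a generalized inverse of `S`, that is `S G S = S`, the form `xᵀ S x` equals
`(S x)ᵀ G (S x)`. -/
theorem exists_abs_energy_le_residual {S : Matrix ι ι ℝ} (hS : S.IsSymm) :
    ∃ B : ℝ, 0 ≤ B ∧ ∀ x : ι → ℝ, |energy S x| ≤ B * ‖S.mulVec x‖ ^ 2 := by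
  let f := Matrix.toLin' S
  obtain ⟨g, hg⟩ := f.rangeRestrict.exists_rightInverse_of_surjective f.range_rangeRestrict
  obtain ⟨G, hG⟩ := g.exists_extend
  obtain ⟨B, hB, h⟩ := exists_abs_energy_le_norm (LinearMap.toMatrix' G)
  refine ⟨B, hB, fun x => ?_⟩
  have h1 : S.mulVec (G (S.mulVec x)) = S.mulVec x := by
    have h2 : G (S.mulVec x) = g (f.rangeRestrict x) :=
      LinearMap.congr_fun hG (f.rangeRestrict x)
    have h3 := congrArg Subtype.val (LinearMap.congr_fun hg (f.rangeRestrict x))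
    rw [h2]
    simpa [f] using h3
  have h4 : energy S x = S.mulVec x ⬝ᵥ (LinearMap.toMatrix' G).mulVec (S.mulVec x) := by
    rw [LinearMap.toMatrix'_mulVec, energy, ← h1, Matrix.dotProduct_mulVec,
      ← Matrix.mulVec_transpose, hS.eq, h1]
  rw [h4]
  exact h _

/-- Negative energy grows geometrically under Gauss–Seidel sweeps, hence so does the orbit. -/
theorem exists_gsSweep_growth {S : Matrix ι ι ℝ} (hS : S.IsSymm) (hd : ∀ i, 0 < S i i)
    {l : List ι} (hl : ∀ i, i ∈ l) {x : ι → ℝ} (hx : energy S x < 0) :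
    ∃ c ρ : ℝ, 0 < c ∧ 1 < ρ ∧ ∀ m : ℕ, c * ρ ^ m ≤ ‖(gsSweep S l)^[m] x‖ := by
  obtain ⟨K, hK, h1⟩ := exists_mulVec_sq_le hS hd l
  obtain ⟨B, hB, h2⟩ := exists_abs_energy_le_residual hS
  obtain ⟨D, hD, h3⟩ := exists_abs_energy_le_norm S
  have h4 : ∀ z, energy S z < 0 →
      energy S (gsSweep S l z) ≤ (1 + (B * K + 1)⁻¹) * energy S z := by
    intro z hz
    obtain ⟨hle, hres⟩ := h1 z
    set a := energy S z - energy S (gsSweep S l z) with ha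
    have ha0 : 0 ≤ a := sub_nonneg.2 hle
    have h5 : ‖S.mulVec z‖ ^ 2 ≤ K * a := by
      rw [← Real.sqrt_le_sqrt_iff (by positivity), Real.sqrt_sq (norm_nonneg _),
        pi_norm_le_iff_of_nonneg (Real.sqrt_nonneg _)]
      exact fun j => Real.le_sqrt_of_sq_le (by simpa using hres j (hl j))
    have h6 : -energy S z ≤ (B * K + 1) * a := by
      have := mul_le_mul_of_nonneg_left h5 hB
      have := (neg_le_abs _).trans (h2 z)
      nlinarith
    have h7 : (B * K + 1)⁻¹ * (-energy S z) ≤ a := by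
      rw [inv_mul_le_iff₀ (by positivity)]
      exact h6
    linarith
  set q := 1 + (B * K + 1)⁻¹ with hq
  have hq1 : 1 < q := by
    have : 0 < (B * K + 1)⁻¹ := by positivity
    linarith
  -- once negative, the energy stays negative, so the estimate `h4` can be iterated
  have h5 : ∀ m : ℕ, energy S ((gsSweep S l)^[m] x) ≤ q ^ m * energy S x := by
    intro m
    induction m with
    | zero => simp
    | succ m ih =>
      rw [Function.iterate_succ_apply', pow_succ', mul_assoc]
      have h6 : q ^ m * energy S x < 0 := mul_neg_of_pos_of_neg (by positivity) hx
      exact (h4 _ (ih.trans_lt h6)).trans (mul_le_mul_of_nonneg_left ih (by positivity))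
  -- the energy is quadratic, at most `D ‖z‖²` in modulus, hence the square roots; `D + 1` is used
  -- in place of `D` only to have a positive denominator
  refine ⟨√(-energy S x / (D + 1)), √q, Real.sqrt_pos.2 (div_pos (neg_pos.2 hx) (by positivity)),
    Real.lt_sqrt_of_sq_lt (by simpa using hq1), fun m => ?_⟩
  refine abs_le_of_sq_le_sq' ?_ (norm_nonneg _) |>.2
  rw [mul_pow, ← pow_mul, mul_comm m 2, pow_mul,
    Real.sq_sqrt (zero_le_one.trans hq1.le), Real.sq_sqrt (div_nonneg (neg_nonneg.2 hx.le) (by positivity)), div_mul_eq_mul_div,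
    div_le_iff₀ (by positivity)]
  have h6 := (neg_le_abs _).trans (h3 ((gsSweep S l)^[m] x))
  have h7 := h5 m
  nlinarith [sq_nonneg ‖(gsSweep S l)^[m] x‖]

end GaussSeidel

/-! ### Optimality from positive semidefiniteness -/

/-- `C + D_y`, the matrix of the dual slack at `V`. -/
noncomputable def slack {k n : ℕ} (C : Matrix (Fin n) (Fin n) ℝ) (V : Config k n) : Matrix (Fin n) (Fin n) ℝ :=
  offDiag C + Matrix.diagonal (mixNorm C V)

theorem slack_apply_self {k n : ℕ} (C : Matrix (Fin n) (Fin n) ℝ) (V : Config k n) (i : Fin n) :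
    slack C V i i = ‖mixVec C V i‖ := by
  simp [slack, offDiag, mixNorm]

/-- On matrices with unit diagonal, the objective `⟨C, X⟩` differs from the pairing of `X` with
`C + D_y` only by a constant. -/
theorem trace_mul_eq {n : ℕ} (C : Matrix (Fin n) (Fin n) ℝ) (y : Fin n → ℝ)
    {X : Matrix (Fin n) (Fin n) ℝ} (hX : ∀ i, X i i = 1) :
    (C.transpose * X).trace
      = ((offDiag C + Matrix.diagonal y).transpose * X).trace + ∑ i, (C i i - y i) := by
  have hC : C = (offDiag C + Matrix.diagonal y) + Matrix.diagonal fun i => C i i - y i := by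
    ext i j
    by_cases h : i = j
    · subst h
      simp [offDiag]
    · simp [offDiag, h]
  conv_lhs => rw [hC]
  rw [Matrix.transpose_add, add_mul, Matrix.trace_add, Matrix.diagonal_transpose]
  congr 1
  simp [Matrix.trace, Matrix.diagonal_mul, hX]

open scoped MatrixOrder in
theorem trace_mul_nonneg {n : ℕ} {A X : Matrix (Fin n) (Fin n) ℝ} (hA : A.PosSemidef)
    (hX : X.PosSemidef) : 0 ≤ (A * X).trace := by
  obtain ⟨B, rfl⟩ := CStarAlgebra.nonneg_iff_eq_star_mul_self.1 hA.nonneg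
  rw [Matrix.trace_mul_comm, ← Matrix.mul_assoc, Matrix.trace_mul_comm, ← Matrix.mul_assoc]
  exact (hX.mul_mul_conjTranspose_same B).trace_nonneg

/-- Weak duality: if the slack matrix is positive semidefinite, then `VᵀV` is optimal. -/
theorem isSDPOptimal_of_posSemidef {k n : ℕ} {C : Matrix (Fin n) (Fin n) ℝ} {V : Config k n}
    (hV : IsFirstOrderCritical C V) (hS : (slack C V).PosSemidef) :
    IsSDPOptimal C (Matrix.gram ℝ V) := by
  have hdiag : ∀ i, Matrix.gram ℝ V i i = 1 := fun i => by
    simp [Matrix.gram_apply, hV.norm_eq_one]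
  have hzero : (slack C V).transpose * Matrix.gram ℝ V = 0 := by
    ext i j
    have h := congrArg (fun u => inner ℝ u (V j)) (hV.mul_eq_zero i)
    simp only [sum_inner, inner_smul_left, inner_zero_left, conj_trivial] at h
    simpa only [Matrix.mul_apply, slack, Matrix.gram_apply, Matrix.transpose_apply,
      Matrix.zero_apply] using h
  refine ⟨⟨Matrix.posSemidef_gram ℝ V, hdiag⟩, fun Y hY => ?_⟩
  rw [trace_mul_eq C (mixNorm C V) hdiag, trace_mul_eq C (mixNorm C V) hY.2]
  change ((slack C V).transpose * Matrix.gram ℝ V).trace + _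
    ≤ ((slack C V).transpose * Y).trace + _
  rw [hzero, Matrix.trace_zero]
  have := trace_mul_nonneg hS.transpose hY.1
  linarith

/-! ### The derivative of the Mixing map at a critical point -/

section Derivative

variable {k n : ℕ} {C : Matrix (Fin n) (Fin n) ℝ} {V : Config k n}

theorem IsFirstOrderCritical.mixVec_eq (hC : C.IsSymm) (hV : IsFirstOrderCritical C V)
    (i : Fin n) : mixVec C V i = -(‖mixVec C V i‖ • V i) := by
  have h := hV.mul_eq_zero i
  simp only [Matrix.add_apply, add_smul, Finset.sum_add_distrib] at h
  have h1 : ∑ j, offDiag C j i • V j = mixVec C V i := by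
    refine Finset.sum_congr rfl fun j _ => ?_
    simp only [offDiag, Matrix.of_apply, eq_comm (a := i), hC.apply]
  have h2 : ∑ j, Matrix.diagonal (mixNorm C V) j i • V j = ‖mixVec C V i‖ • V i := by
    rw [Finset.sum_eq_single i (fun j _ hj => by simp [hj]) (by simp)]
    simp [mixNorm]
  rw [h1, h2] at h
  exact eq_neg_of_add_eq_zero_left h

theorem IsFirstOrderCritical.mixStep_eq (hC : C.IsSymm) (hV : IsFirstOrderCritical C V)
    {i : Fin n} (hi : mixVec C V i ≠ 0) : mixStep C V i = V := by
  rw [mixStep]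
  -- rewrite `gᵢ` as `-‖gᵢ‖ vᵢ` where it is scaled, but not inside the norm
  nth_rewrite 2 [hV.mixVec_eq hC i]
  rw [smul_neg, neg_neg, inv_smul_smul₀ (norm_ne_zero_iff.2 hi), Function.update_eq_self]

/-- Normalization is differentiable away from zero, and its derivative acts as `‖g‖⁻¹` on the
directions orthogonal to the base point. -/
theorem exists_hasFDerivAt_normalize {E : Type*} [NormedAddCommGroup E] [InnerProductSpace ℝ E]
    {g : E} (hg : g ≠ 0) : ∃ L : E →L[ℝ] E, HasFDerivAt (fun u : E => -(‖u‖⁻¹ • u)) L g ∧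
      ∀ h, inner ℝ g h = 0 → L h = -(‖g‖⁻¹ • h) := by
  have h0 : ‖g‖ ≠ 0 := norm_ne_zero_iff.2 hg
  have h1 : HasFDerivAt (fun u : E => √(‖u‖ ^ 2)) _ g :=
    (hasStrictFDerivAt_norm_sq g).hasFDerivAt.sqrt (by positivity)
  simp only [Real.sqrt_sq (norm_nonneg _)] at h1
  have h2 := ((hasDerivAt_inv h0).comp_hasFDerivAt g h1).smul (hasFDerivAt_id g)
  refine ⟨_, h2.neg, fun h hh => ?_⟩
  simp [hh]

/-- Moving the columns of `V` along a common direction `r` orthogonal to all of them, an update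
acts on the coefficients as a Gauss–Seidel step for `C + D_y`. -/
theorem exists_hasFDerivAt_mixStep (hC : C.IsSymm) (hV : IsFirstOrderCritical C V)
    {r : EuclideanSpace ℝ (Fin k)} (hr : ∀ i, inner ℝ (V i) r = 0)
    {i : Fin n} (hi : mixVec C V i ≠ 0) :
    ∃ L : Config k n →L[ℝ] Config k n, HasFDerivAt (fun U => mixStep C U i) L V ∧
      ∀ x : Fin n → ℝ, L (fun j => x j • r) = fun j => gsStep (slack C V) x i j • r := by
  obtain ⟨N, hN, hN'⟩ := exists_hasFDerivAt_normalize hi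
  let A : Config k n →L[ℝ] EuclideanSpace ℝ (Fin k) :=
    ∑ j, offDiag C i j • ContinuousLinearMap.proj (R := ℝ)
      (φ := fun _ : Fin n => EuclideanSpace ℝ (Fin k)) j
  have hA : ∀ U, A U = mixVec C U i := fun U => by simp [A, mixVec]
  have hmix : HasFDerivAt (fun U : Config k n => mixVec C U i) A V := by
    simp only [← hA]
    exact A.hasFDerivAt
  have hcomp := HasFDerivAt.comp V hN hmix
  let L : Config k n →L[ℝ] Config k n := ContinuousLinearMap.pi fun j =>
    if j = i then N.comp A else ContinuousLinearMap.proj j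
  refine ⟨L, hasFDerivAt_pi.2 fun j => ?_, fun x => ?_⟩
  · by_cases hj : j = i
    · subst hj
      simpa [mixStep, Function.comp_def] using hcomp
    · simpa [mixStep, hj] using hasFDerivAt_apply j V
  · have hy : ‖mixVec C V i‖ ≠ 0 := norm_ne_zero_iff.2 hi
    have hAx : A (fun j => x j • r) = (∑ j, offDiag C i j * x j) • r := by
      simp [A, Finset.sum_smul, mul_smul]
    have hS : (slack C V).mulVec x i = ∑ j, offDiag C i j * x j + ‖mixVec C V i‖ * x i := by
      rw [slack, Matrix.add_mulVec, Pi.add_apply, Matrix.mulVec_diagonal]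
      rfl
    funext j
    by_cases hj : j = i
    · subst hj
      have h1 : L (fun j => x j • r) j = N (A fun j => x j • r) := by simp [L]
      rw [h1, hN' _ (by rw [hAx, hV.mixVec_eq hC]; simp [inner_smul_left, inner_smul_right, hr]),
        hAx, gsStep, Function.update_self, slack_apply_self, hS, smul_smul, ← neg_smul]
      congr 1
      field_simp
      ring
    · simp [L, hj, gsStep]

theorem exists_hasFDerivAt_foldl (hC : C.IsSymm) (hV : IsFirstOrderCritical C V)
    (hn : ∀ i, mixVec C V i ≠ 0) {r : EuclideanSpace ℝ (Fin k)} (hr : ∀ i, inner ℝ (V i) r = 0)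
    (l : List (Fin n)) :
    ∃ L : Config k n →L[ℝ] Config k n, HasFDerivAt (fun U => l.foldl (mixStep C) U) L V ∧
      ∀ x : Fin n → ℝ, L (fun j => x j • r) = fun j => gsSweep (slack C V) l x j • r := by
  induction l with
  | nil => exact ⟨.id ℝ _, hasFDerivAt_id V, fun x => rfl⟩
  | cons i l ih =>
    obtain ⟨L, hL, hLx⟩ := ih
    obtain ⟨L₁, hL₁, hL₁x⟩ := exists_hasFDerivAt_mixStep hC hV hr (hn i)
    refine ⟨L.comp L₁, ?_, fun x => ?_⟩
    · have hfix := hV.mixStep_eq hC (hn i)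
      exact HasFDerivAt.comp (g := fun U => l.foldl (mixStep C) U) V (by rwa [hfix]) hL₁
    · rw [ContinuousLinearMap.comp_apply, hL₁x, hLx]
      rfl

theorem IsFirstOrderCritical.mixMap_eq (hC : C.IsSymm) (hV : IsFirstOrderCritical C V)
    (hn : ∀ i, mixVec C V i ≠ 0) : mixMap C V = V := by
  have h : ∀ l : List (Fin n), l.foldl (mixStep C) V = V := fun l => by
    induction l with
    | nil => rfl
    | cons i l ih => rw [List.foldl_cons, hV.mixStep_eq hC (hn i), ih]
  exact h _

end Derivative

/-! ### The spectral radius of the Jacobian -/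

/-- The complex coordinate vector of `U`. -/
def coords {k n : ℕ} (U : Config k n) : Fin n × Fin k → ℂ :=
  fun p => (U p.1 p.2 : ℂ)

theorem jacobian_mulVec_coords {k n : ℕ} (F : Config k n → Config k n) (V U : Config k n) :
    ((jacobian F V).map (fun x : ℝ => (x : ℂ))).mulVec (coords U) = coords (fderiv ℝ F V U) := by
  have hU : U = ∑ q : Fin n × Fin k,
      U q.1 q.2 • Pi.single q.1 (EuclideanSpace.single q.2 (1 : ℝ)) := by
    funext i
    ext a
    rw [Fintype.sum_prod_type, Finset.sum_apply, Finset.sum_eq_single i]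
    · simp [Finset.sum_apply, Pi.single_apply]
    · intro j _ hj
      simp [Finset.sum_apply, hj.symm]
    · simp
  funext p
  conv_rhs => rw [hU]
  simp only [Matrix.mulVec, dotProduct, coords, jacobian, Matrix.map_apply, Matrix.of_apply,
    map_sum, map_smul, Finset.sum_apply, Pi.smul_apply]
  simp [mul_comm]

theorem isUnstableFixedPoint_of_energy_neg {k n : ℕ} {C : Matrix (Fin n) (Fin n) ℝ}
    {V : Config k n} (hC : C.IsSymm) (hV : IsFirstOrderCritical C V)
    (hn : ∀ i, mixVec C V i ≠ 0) {r : EuclideanSpace ℝ (Fin k)} (hr0 : r ≠ 0)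
    (hr : ∀ i, inner ℝ (V i) r = 0) (hS : (slack C V).IsSymm) {x : Fin n → ℝ}
    (hx : energy (slack C V) x < 0) : IsUnstableFixedPoint (mixMap C) V := by
  obtain ⟨L, hL, hLx⟩ := exists_hasFDerivAt_foldl hC hV hn hr (List.finRange n)
  change HasFDerivAt (mixMap C) L V at hL
  refine ⟨hV.mixMap_eq hC hn, hL.differentiableAt, ?_⟩
  obtain ⟨c, ρ, hc, hρ, hgrow⟩ := exists_gsSweep_growth hS
    (fun i => by rw [slack_apply_self]; exact norm_pos_iff.2 (hn i)) (List.mem_finRange) hx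
  set A := (jacobian (mixMap C) V).map (fun x : ℝ => (x : ℂ)) with hA
  have hpow : ∀ m : ℕ, (A ^ m).mulVec (coords fun j => x j • r)
      = coords fun j => ((gsSweep (slack C V) (List.finRange n))^[m] x) j • r := by
    intro m
    induction m with
    | zero => simp
    | succ m ih =>
      rw [pow_succ', ← Matrix.mulVec_mulVec, ih, hA, jacobian_mulVec_coords, hL.fderiv, hLx,
        Function.iterate_succ_apply']
  obtain ⟨a, ha⟩ : ∃ a, r a ≠ 0 := by
    by_contra! h
    exact hr0 (by ext a; simpa using h a)
  have ha' : 0 < |r a| := abs_pos.2 ha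
  have hbound : ∀ z : Fin n → ℝ, ‖z‖ * |r a| ≤ ‖coords fun j => z j • r‖ := by
    intro z
    rw [← le_div_iff₀ ha', pi_norm_le_iff_of_nonneg (by positivity)]
    intro j
    rw [le_div_iff₀ ha']
    simpa [coords] using norm_le_pi_norm (coords fun j => z j • r) (j, a)
  have hle := le_spectralRadius_of_growth A (coords fun j => x j • r) (c := c * |r a|) (ρ := ρ)
    (mul_pos hc ha') (by linarith) fun m => by
      rw [hpow]
      refine le_trans ?_ (hbound _)
      rw [mul_right_comm]
      exact mul_le_mul_of_nonneg_right (hgrow m) ha'.le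
  exact lt_of_lt_of_le (by simpa using hρ) hle

end MixingMethod

theorem mainTheorem2 (n k : ℕ) (hk : Real.sqrt (2 * (n : ℝ)) < (k : ℝ)) :
    ∀ᵐ w : Sym2 (Fin n) → ℝ ∂volume,
      ∀ V : MixingMethod.Config k n,
        MixingMethod.IsFirstOrderCritical (MixingMethod.symMatrix w) V →
        MixingMethod.IsNondegenerate (MixingMethod.symMatrix w) V →
        ¬ MixingMethod.IsSDPOptimal (MixingMethod.symMatrix w) (Matrix.gram ℝ V) →
        MixingMethod.IsUnstableFixedPoint
          (MixingMethod.mixMap (MixingMethod.symMatrix w)) V := by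
  have hk' : 2 * n < k * k := by
    have h := (Real.sqrt_lt' (lt_of_le_of_lt (Real.sqrt_nonneg _) hk)).1 hk
    rw [sq] at h
    exact_mod_cast h
  filter_upwards [MixingMethod.ae_exists_orthogonal hk'] with w hw V hV hnd hopt
  obtain ⟨r, hr0, hr⟩ := hw V hV
  obtain ⟨δ, hδ, hn⟩ := hnd
  have hC : (MixingMethod.symMatrix w).IsSymm :=
    Matrix.IsSymm.ext fun i j => congrArg w Sym2.eq_swap
  have hS : (MixingMethod.slack (MixingMethod.symMatrix w) V).IsSymm :=
    Matrix.IsSymm.add (Matrix.IsSymm.ext fun i j => MixingMethod.offDiag_symMatrix_comm w j i)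
      (Matrix.diagonal_transpose _)
  obtain ⟨x, hx⟩ : ∃ x, MixingMethod.energy (MixingMethod.slack (MixingMethod.symMatrix w) V) x
      < 0 := by
    by_contra! h
    exact hopt (MixingMethod.isSDPOptimal_of_posSemidef hV
      (.of_dotProduct_mulVec_nonneg (by rwa [Matrix.IsHermitian, Matrix.conjTranspose_eq_transpose_of_trivial]) h))
  exact MixingMethod.isUnstableFixedPoint_of_energy_neg hC hV
    (fun i => norm_pos_iff.1 (hδ.trans_le (hn i))) hr0 hr hS hx
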